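/- Let $q$ be a prime power, let $t\ge 1$ be an integer, and write $V_I=\{x\in\mathbf F_q^n : x_i=0 \text{ for } i\notin I\}$ for $I\subseteq\{1,\dots,n\}$. For linear codes $C_2\subseteq C_1\subseteq\mathbf F_q^n$ with $\dim C_1-\dim C_2\ge t$, the $t$-th relative generalized Hamming weight is $$M_t(C_1,C_2)=\min\{|I| : I\subseteq\{1,\dots,n\},\ \dim(C_1\cap V_I)-\dim(C_2\cap V_I)\ge t\}.$$ For real $R_1,R_2$ with $0\le R_1\le 1$ and $R_2\ge 0$ let $$\delta^0_q(t,R_1,R_2)=\limsup_{n\to\infty}\ \max\Big\{\tfrac dn : d\in\mathbf Z_{\ge 0},\ \text{there are linear codes } C_2\subseteq C_1\subseteq\mathbf F_q^n \text{ with } \dim C_1-\dim C_2\ge t,\ \dim C_1\ge nR_1,\ \dim C_2\le nR_2,\ M_t(C_1,C_2)\ge d\Big\},$$ (the set is non-empty for all $n\ge t$), and let $H_q(x)=-x\log_q x-(1-x)\log_q(1-x)$ for $0\le x\le 1$, with $0\log_q 0=0$. Theorem. 1. For all $0\le R_1\le 1$, $\ \delta^0_q(t,R_1,R_1)=1-R_1$.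 2. For all $0\le R_1\le 1$ and $R_2\ge 0$: every $\delta\in[0,1]$ that satisfies $$\delta\le 1-\frac{H_q(\delta)}{t}-R_1$$ satisfies $\delta^0_q(t,R_1,R_2)\ge\delta$. Moreover, the number $\delta=\delta^0_q(t,R_1,R_2)$ itself satisfies $$\delta\ge 1-\frac{H_q(\delta)}{t}-R_1 .$$ -/

import Mathlib

open Filter Module

namespace RGHW

variable {F : Type*} [Field F]

/-- The coordinate subspace `V_I` of `F^n`: the vectors that vanish outside `I`. -/
def coordSubspace (F : Type*) [Field F] {n : ℕ} (I : Finset (Fin n)) :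
    Submodule F (Fin n → F) where
  carrier := {x | ∀ i, i ∉ I → x i = 0}
  zero_mem' := fun _ _ => rfl
  add_mem' := by
    intro x y hx hy i hi
    simp [hx i hi, hy i hi]
  smul_mem' := by
    intro c x hx i hi
    simp [hx i hi]

/-- The `t`-th relative generalized Hamming weight `M_t(C₁, C₂)`: the least size of an index set
`I` with `dim (C₁ ∩ V_I) - dim (C₂ ∩ V_I) ≥ t`. For `C₂ ⊆ C₁` such an `I` exists exactly when
`t ≤ dim C₁ - dim C₂`, and the weight is used only in that case. -/
noncomputable def weight {n : ℕ} (t : ℕ) (C₁ C₂ : Submodule F (Fin n → F)) : ℕ :=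
  sInf {w : ℕ | ∃ I : Finset (Fin n), I.card = w ∧
    t + finrank F ↥(C₂ ⊓ coordSubspace F I) ≤ finrank F ↥(C₁ ⊓ coordSubspace F I)}

/-- The ratios `d / n` such that some nested pair `C₂ ⊆ C₁ ⊆ F^n` with `dim C₁ ≥ n R₁`,
`dim C₂ ≤ n R₂`, whose weight `M_t(C₁, C₂)` is defined (`t ≤ dim C₁ - dim C₂`),
satisfies `M_t(C₁, C₂) ≥ d`. -/
def ratios (F : Type*) [Field F] (t : ℕ) (R₁ R₂ : ℝ) (n : ℕ) : Set ℝ :=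
  {x | ∃ d : ℕ, x = (d : ℝ) / (n : ℝ) ∧
    ∃ C₁ C₂ : Submodule F (Fin n → F), C₂ ≤ C₁ ∧
      t + finrank F C₂ ≤ finrank F C₁ ∧
      (n : ℝ) * R₁ ≤ (finrank F C₁ : ℝ) ∧
      (finrank F C₂ : ℝ) ≤ (n : ℝ) * R₂ ∧
      d ≤ weight t C₁ C₂}

/-- The asymptotic metric `δ⁰_q(t, R₁, R₂)`, where `q` is the number of elements of `F`. For
`0 ≤ R₁ ≤ 1`, `0 ≤ R₂` and `n ≥ t` the supremum is a maximum, see `exists_isGreatest_ratios`. -/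
noncomputable def deltaZero (F : Type*) [Field F] (t : ℕ) (R₁ R₂ : ℝ) : ℝ :=
  limsup (fun n : ℕ => sSup (ratios F t R₁ R₂ n)) atTop

/-- The entropy function `H_q(x) = -x log_q x - (1 - x) log_q (1 - x)` (with `0 log 0 = 0`). -/
noncomputable def entropy (q : ℕ) (x : ℝ) : ℝ :=
  -x * Real.logb q x - (1 - x) * Real.logb q (1 - x)

theorem coordSubspace_univ {n : ℕ} :
    coordSubspace F (Finset.univ : Finset (Fin n)) = ⊤ := by
  ext x
  simp [coordSubspace]

theorem weight_le {n t : ℕ} {C₁ C₂ : Submodule F (Fin n → F)}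
    (h : t + finrank F C₂ ≤ finrank F C₁) : weight t C₁ C₂ ≤ n := by
  refine Nat.sInf_le ⟨Finset.univ, by simp, ?_⟩
  rw [coordSubspace_univ, inf_top_eq, inf_top_eq]
  exact h

theorem exists_isGreatest_ratios {t n : ℕ} {R₁ R₂ : ℝ} (hR₁ : R₁ ≤ 1) (hR₂ : 0 ≤ R₂)
    (hn : t ≤ n) : ∃ x, IsGreatest (ratios F t R₁ R₂ n) x := by
  have hfin : (ratios F t R₁ R₂ n).Finite := by
    refine ((Finset.range (n + 1)).finite_toSet.image
      (fun d : ℕ => (d : ℝ) / (n : ℝ))).subset ?_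
    rintro x ⟨d, rfl, C₁, C₂, -, h, -, -, hd⟩
    refine ⟨d, ?_, rfl⟩
    have := hd.trans (weight_le h)
    simpa using Nat.lt_succ_of_le this
  have hne : (ratios F t R₁ R₂ n).Nonempty := by
    refine ⟨0, 0, by simp, ⊤, ⊥, bot_le, by simpa using hn, ?_, ?_, Nat.zero_le _⟩
    · have h0 : (0 : ℝ) ≤ n := Nat.cast_nonneg n
      simpa using mul_le_of_le_one_right h0 hR₁
    · simpa using mul_nonneg (Nat.cast_nonneg n) hR₂
  obtain ⟨x, hx, hmax⟩ := hfin.exists_maximal hne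
  exact ⟨x, hx, fun y hy => (le_total y x).elim id (fun h => hmax hy h)⟩

end RGHW

/-!
**Part 1.** Only the zero word of `C₂` vanishes on a suitable set of at most `dim C₂` coordinates.
Enlarging this set to one with `dim C₁ - t` elements and passing to the complement gives a set `A`
of `n - dim C₁ + t` coordinates with `C₂ ∩ V_A = 0` and `dim (C₁ ∩ V_A) ≥ t`, hence the Singleton
bound `M_t(C₁, C₂) ≤ n - dim C₁ + t`. It is asymptotically attained by `C₂ = V_I` and
`C₁ = V_K + ⟨(1, …, 1)⟩` with `I ⊆ K` and `|K| = |I| + t - 1`: if `V_A` captures all `t` additional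
dimensions, then `C₁ = (C₁ ∩ V_A) + V_I`, so the all-ones word lies in `V_{A ∪ I}` and
`|A| ≥ n - |I|`.

**Part 2** is a Gilbert–Varshamov argument. The kernel of a random linear map `F^n → F^m` contains
a given linearly independent `t`-tuple with probability `q^(-tm)`. With `x = d / n`, at most
`n.choose d * q^(td) ≤ q^(tn (x + H_q(x) / t))` tuples are supported in a set of `d` coordinates,
so some kernel `C` has `M_t(C, 0) ≥ d` as soon as `x + H_q(x) / t < m / n`. As `x + H_q(x) / t` is
concave with value `1` at `x = 1`, it increases strictly while it is below `1`, which settles the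
case of equality. Every `x > δ⁰_q` thus violates the condition, and by continuity
`δ⁰_q + H_q(δ⁰_q) / t ≥ 1 - R₁`.
-/

namespace RGHW

variable {F : Type*} [Field F]

section LinearAlgebra

variable {V W : Type*} [AddCommGroup V] [Module F V] [AddCommGroup W] [Module F W]

theorem inf_sup_eq_left_of_finrank_le [FiniteDimensional F V] {C₁ C₂ U : Submodule F V}
    (hle : C₂ ≤ C₁)
    (h : finrank F C₁ + finrank F ↥(C₂ ⊓ U) ≤ finrank F ↥(C₁ ⊓ U) + finrank F C₂) :
    C₁ ⊓ U ⊔ C₂ = C₁ := by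
  have hinf : C₁ ⊓ U ⊓ C₂ = C₂ ⊓ U := by rw [inf_right_comm, inf_eq_right.2 hle]
  have hdim := Submodule.finrank_sup_add_finrank_inf_eq (C₁ ⊓ U) C₂
  rw [hinf] at hdim
  exact Submodule.eq_of_le_of_finrank_le (sup_le inf_le_left hle) (by omega)

variable {ι : Type*}

theorem exists_linearMap_apply_eq {v : ι → V} (hv : LinearIndependent F v) (w : ι → W) :
    ∃ f : V →ₗ[F] W, ∀ i, f (v i) = w i := by
  obtain ⟨f, hf⟩ := LinearMap.exists_extend ((Basis.span hv).constr F w)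
  refine ⟨f, fun i => ?_⟩
  rw [← (Basis.span hv).constr_basis F w i, ← hf, LinearMap.comp_apply, Submodule.subtype_apply,
    Basis.span_apply]

theorem card_linearMap_annihilating_mul [Finite ι] {v : ι → V} (hv : LinearIndependent F v) :
    Nat.card {f : V →ₗ[F] W // ∀ i, f (v i) = 0} * Nat.card W ^ Nat.card ι =
      Nat.card (V →ₗ[F] W) := by
  let ev : (V →ₗ[F] W) →ₗ[F] (ι → W) := LinearMap.pi fun i => LinearMap.applyₗ (v i)
  have hsurj : Function.Surjective ev := fun w =>
    (exists_linearMap_apply_eq hv w).imp fun _ hf => funext hf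
  have hmem (f : V →ₗ[F] W) : (∀ i, f (v i) = 0) ↔ f ∈ LinearMap.ker ev := by
    simp [ev, LinearMap.mem_ker, funext_iff]
  rw [Submodule.card_eq_card_quotient_mul_card (LinearMap.ker ev),
    Nat.card_congr (ev.quotKerEquivOfSurjective hsurj).toEquiv, Nat.card_fun,
    Nat.card_congr (Equiv.subtypeEquivRight hmem)]

theorem exists_linearMap_forall_exists_apply_ne_zero [Finite ι] [Finite V] [Finite W]
    (S : Finset (ι → V)) (hS : ∀ v ∈ S, LinearIndependent F v)
    (hcard : S.card < Nat.card W ^ Nat.card ι) :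
    ∃ f : V →ₗ[F] W, ∀ v ∈ S, ∃ i, f (v i) ≠ 0 := by
  classical
  have : Fintype (V →ₗ[F] W) := @Fintype.ofFinite _ (DFunLike.finite _)
  let K (v : ι → V) : Finset (V →ₗ[F] W) := {f | ∀ i, f (v i) = 0}
  have hK : ∀ v ∈ S, (K v).card * Nat.card W ^ Nat.card ι = Fintype.card (V →ₗ[F] W) := by
    intro v hv
    simpa [K, Fintype.card_subtype] using card_linearMap_annihilating_mul (W := W) (hS v hv)
  by_contra! hall
  have hcover : Finset.univ ⊆ S.biUnion K := fun f _ => by simpa [K] using hall f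
  refine (Nat.mul_lt_mul_of_pos_right hcard
    (Fintype.card_pos (α := V →ₗ[F] W))).not_ge ?_
  calc Nat.card W ^ Nat.card ι * Fintype.card (V →ₗ[F] W)
      ≤ Nat.card W ^ Nat.card ι * ∑ v ∈ S, (K v).card :=
        Nat.mul_le_mul_left _ ((Finset.card_le_card hcover).trans Finset.card_biUnion_le)
    _ = ∑ _ ∈ S, Fintype.card (V →ₗ[F] W) := by
        rw [mul_comm, Finset.sum_mul, Finset.sum_congr rfl hK]
    _ = S.card * Fintype.card (V →ₗ[F] W) := by rw [Finset.sum_const, smul_eq_mul]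

theorem exists_submodule_forall_finrank_inf_lt [Fintype F] [FiniteDimensional F V]
    (s : Finset ι) (U : ι → Submodule F V) {m t : ℕ}
    (h : ∑ i ∈ s, Fintype.card F ^ (finrank F (U i) * t) < Fintype.card F ^ (m * t)) :
    ∃ C : Submodule F V, finrank F V ≤ finrank F C + m ∧
      ∀ i ∈ s, finrank F ↥(C ⊓ U i) < t := by
  classical
  have : Finite V := Module.finite_of_finite F
  have : Fintype V := Fintype.ofFinite V
  let T (i : ι) : Finset (Fin t → V) :=
    Finset.univ.image fun (w : Fin t → U i) j => (w j : V)
  have hT (i : ι) : (T i).card ≤ Fintype.card F ^ (finrank F (U i) * t) :=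
    Finset.card_image_le.trans_eq <| by
      rw [Finset.card_univ, Fintype.card_fun, Fintype.card_fin, pow_mul,
        Module.card_eq_pow_finrank (K := F)]
  let S : Finset (Fin t → V) := (s.biUnion T).filter fun v => LinearIndependent F v
  have hS : S.card < Nat.card (Fin m → F) ^ Nat.card (Fin t) := by
    simp only [Nat.card_eq_fintype_card, Fintype.card_fun, Fintype.card_fin, ← pow_mul]
    exact ((Finset.card_filter_le _ _).trans (Finset.card_biUnion_le.trans
      (Finset.sum_le_sum fun i _ => hT i))).trans_lt h
  obtain ⟨f, hf⟩ := exists_linearMap_forall_exists_apply_ne_zero (F := F) S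
    (fun v hv => (Finset.mem_filter.1 hv).2) hS
  refine ⟨LinearMap.ker f, ?_, fun i hi => ?_⟩
  · have hrange : finrank F (LinearMap.range f) ≤ m := by simpa using (LinearMap.range f).finrank_le
    have hdim := f.finrank_range_add_finrank_ker
    omega
  · by_contra! hle
    obtain ⟨w, hw⟩ := exists_linearIndependent_of_le_finrank hle
    have hwV : LinearIndependent F fun j => (w j : V) :=
      hw.map' (Submodule.subtype _) (Submodule.ker_subtype _)
    have hwT : (fun j => (w j : V)) ∈ T i :=
      Finset.mem_image.2 ⟨fun j => ⟨w j, (w j).2.2⟩, Finset.mem_univ _, rfl⟩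
    obtain ⟨j, hj⟩ := hf _ (Finset.mem_filter.2 ⟨Finset.mem_biUnion.2 ⟨i, hi, hwT⟩, hwV⟩)
    exact hj (w j).2.1

end LinearAlgebra

section CoordSubspace

variable {n : ℕ} {I J : Finset (Fin n)}

theorem mem_coordSubspace {x : Fin n → F} : x ∈ coordSubspace F I ↔ ∀ i, i ∉ I → x i = 0 :=
  Iff.rfl

theorem coordSubspace_mono (h : I ⊆ J) : coordSubspace F I ≤ coordSubspace F J :=
  fun _ hx i hi => hx i fun hI => hi (h hI)

theorem one_mem_coordSubspace : (1 : Fin n → F) ∈ coordSubspace F I ↔ I = Finset.univ := by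
  simp [mem_coordSubspace, Finset.eq_univ_iff_forall]

theorem finrank_coordSubspace (I : Finset (Fin n)) : finrank F (coordSubspace F I) = I.card := by
  have hker : coordSubspace F I =
      ⨅ i ∈ (I : Set (Fin n))ᶜ, LinearMap.ker (LinearMap.proj i : (Fin n → F) →ₗ[F] F) := by
    ext x
    simp [mem_coordSubspace]
  rw [hker, (LinearMap.iInfKerProjEquiv F (fun _ => F) disjoint_compl_right
    (Set.union_compl_self (I : Set (Fin n))).ge).finrank_eq]
  simp

theorem exists_card_le_finrank_and_inf_coordSubspace_compl_eq_bot (C : Submodule F (Fin n → F)) :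
    ∃ J : Finset (Fin n), J.card ≤ finrank F C ∧ C ⊓ coordSubspace F Jᶜ = ⊥ := by
  induction h : finrank F C using Nat.strong_induction_on generalizing C with
  | _ k ih =>
    by_cases hC : C = ⊥
    · exact ⟨∅, by simp, by simp [hC]⟩
    obtain ⟨x, hxC, hx⟩ := C.ne_bot_iff.1 hC
    obtain ⟨i, hi⟩ := Function.ne_iff.1 hx
    let C' := C ⊓ LinearMap.ker (LinearMap.proj i : (Fin n → F) →ₗ[F] F)
    have hlt : finrank F C' < finrank F C :=
      Submodule.finrank_lt_finrank_of_lt (inf_lt_left.2 fun hle => hi (hle hxC))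
    obtain ⟨J, hJ, hJC⟩ := ih _ (h ▸ hlt) C' rfl
    refine ⟨insert i J, (Finset.card_insert_le _ _).trans (by omega), le_bot_iff.1 ?_⟩
    calc C ⊓ coordSubspace F (insert i J)ᶜ
        ≤ C' ⊓ coordSubspace F Jᶜ := fun y hy =>
          ⟨⟨hy.1, hy.2 i (by simp)⟩,
            coordSubspace_mono (Finset.compl_subset_compl.2 (Finset.subset_insert i J)) hy.2⟩
      _ = ⊥ := hJC

end CoordSubspace

section Weight

variable {n t : ℕ} {C₁ C₂ : Submodule F (Fin n → F)}

theorem weight_le_card {I : Finset (Fin n)}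
    (h : t + finrank F ↥(C₂ ⊓ coordSubspace F I) ≤ finrank F ↥(C₁ ⊓ coordSubspace F I)) :
    weight t C₁ C₂ ≤ I.card :=
  Nat.sInf_le ⟨I, rfl, h⟩

theorem exists_card_eq_weight (h : t + finrank F C₂ ≤ finrank F C₁) :
    ∃ I : Finset (Fin n), I.card = weight t C₁ C₂ ∧
      t + finrank F ↥(C₂ ⊓ coordSubspace F I) ≤ finrank F ↥(C₁ ⊓ coordSubspace F I) := by
  refine Nat.sInf_mem (s := {w | ∃ I : Finset (Fin n), I.card = w ∧ _ ≤ _})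
    ⟨n, Finset.univ, by simp, ?_⟩
  rwa [coordSubspace_univ, inf_top_eq, inf_top_eq]

theorem weight_add_finrank_le (h : t + finrank F C₂ ≤ finrank F C₁) :
    weight t C₁ C₂ + finrank F C₁ ≤ n + t := by
  have hn : finrank F C₁ ≤ n := by simpa using C₁.finrank_le
  obtain ⟨J, hJ, hJC⟩ := exists_card_le_finrank_and_inf_coordSubspace_compl_eq_bot C₂
  obtain ⟨K, hJK, hK⟩ := Finset.exists_superset_card_eq (s := J) (n := finrank F C₁ - t)
    (by omega) (by simp; omega)
  have hcard : Kᶜ.card = n - (finrank F C₁ - t) := by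
    rw [Finset.card_compl, hK, Fintype.card_fin]
  have hbot : C₂ ⊓ coordSubspace F Kᶜ = ⊥ :=
    le_bot_iff.1 ((inf_le_inf_left _
      (coordSubspace_mono (Finset.compl_subset_compl.2 hJK))).trans hJC.le)
  have hdim := Submodule.finrank_sup_add_finrank_inf_eq C₁ (coordSubspace F Kᶜ)
  rw [finrank_coordSubspace, hcard] at hdim
  have hsup : finrank F ↥(C₁ ⊔ coordSubspace F Kᶜ) ≤ n := by
    simpa using (C₁ ⊔ coordSubspace F Kᶜ).finrank_le
  have hweight : weight t C₁ C₂ ≤ Kᶜ.card :=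
    weight_le_card (by rw [hbot, finrank_bot]; omega)
  omega

theorem sub_card_le_weight {I : Finset (Fin n)} (hI : coordSubspace F I ≤ C₁) (hone : 1 ∈ C₁)
    (hdim : finrank F C₁ = t + I.card) : n - I.card ≤ weight t C₁ (coordSubspace F I) := by
  obtain ⟨A, hA, hAt⟩ := exists_card_eq_weight (C₁ := C₁) (C₂ := coordSubspace F I)
    (by rw [finrank_coordSubspace, hdim])
  have hsup : C₁ ⊓ coordSubspace F A ⊔ coordSubspace F I = C₁ :=
    inf_sup_eq_left_of_finrank_le hI (by rw [finrank_coordSubspace, hdim]; omega)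
  have hle : C₁ ≤ coordSubspace F (A ∪ I) :=
    hsup.ge.trans (sup_le (inf_le_right.trans (coordSubspace_mono Finset.subset_union_left))
      (coordSubspace_mono Finset.subset_union_right))
  have hcard := Finset.card_union_le A I
  rw [one_mem_coordSubspace.1 (hle hone), Finset.card_univ, Fintype.card_fin] at hcard
  omega

theorem exists_finrank_eq_and_sub_le_weight (F : Type*) [Field F] {k : ℕ} (ht : 1 ≤ t)
    (hk : k + t ≤ n) :
    ∃ C₁ C₂ : Submodule F (Fin n → F), C₂ ≤ C₁ ∧ finrank F C₁ = t + k ∧ finrank F C₂ = k ∧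
      n - k ≤ weight t C₁ C₂ := by
  obtain ⟨K, hK⟩ : ∃ K : Finset (Fin n), K.card = k + t - 1 :=
    (Finset.exists_superset_card_eq (s := ∅) (by simp) (by simp; omega)).imp fun _ => And.right
  obtain ⟨I, hIK, rfl⟩ := Finset.exists_subset_card_eq (s := K) (n := k) (by omega)
  have hone : (1 : Fin n → F) ∉ coordSubspace F K := fun h => by
    have := congrArg Finset.card (one_mem_coordSubspace.1 h)
    rw [hK, Finset.card_univ, Fintype.card_fin] at this
    omega
  have hdim : finrank F ↥(coordSubspace F K ⊔ Submodule.span F {1}) = t + I.card := by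
    rw [Submodule.finrank_sup_span_singleton hone, finrank_coordSubspace, hK]
    omega
  have hle : coordSubspace F I ≤ coordSubspace F K ⊔ Submodule.span F {1} :=
    (coordSubspace_mono hIK).trans le_sup_left
  exact ⟨_, _, hle, hdim, finrank_coordSubspace I, sub_card_le_weight hle
    (Submodule.mem_sup_right (Submodule.mem_span_singleton_self 1)) hdim⟩

theorem le_weight_bot {C : Submodule F (Fin n → F)} {d : ℕ} (hC : t ≤ finrank F C) (hd : d ≤ n)
    (h : ∀ I : Finset (Fin n), I.card = d → finrank F ↥(C ⊓ coordSubspace F I) < t) :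
    d ≤ weight t C ⊥ := by
  obtain ⟨I, hI, hIt⟩ := exists_card_eq_weight (C₁ := C) (C₂ := ⊥) (by simpa using hC)
  by_contra! hlt
  obtain ⟨J, hIJ, hJ⟩ := Finset.exists_superset_card_eq (hI.trans_lt hlt).le (by simpa using hd)
  have hmono : finrank F ↥(C ⊓ coordSubspace F I) ≤ finrank F ↥(C ⊓ coordSubspace F J) :=
    Submodule.finrank_mono (inf_le_inf_left _ (coordSubspace_mono hIJ))
  have := h J hJ
  omega

theorem exists_le_finrank_and_le_weight_bot [Fintype F] {k d : ℕ} (htk : t ≤ k) (hkn : k ≤ n)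
    (hdn : d ≤ n) (h : n.choose d * Fintype.card F ^ (d * t) < Fintype.card F ^ ((n - k) * t)) :
    ∃ C : Submodule F (Fin n → F), k ≤ finrank F C ∧ d ≤ weight t C ⊥ := by
  have hsum : ∑ I ∈ Finset.powersetCard d (Finset.univ : Finset (Fin n)),
      Fintype.card F ^ (finrank F (coordSubspace F I) * t) =
        n.choose d * Fintype.card F ^ (d * t) := by
    rw [Finset.sum_congr rfl fun I hI => by
      rw [finrank_coordSubspace, (Finset.mem_powersetCard.1 hI).2], Finset.sum_const,
      Finset.card_powersetCard, Finset.card_univ, Fintype.card_fin, smul_eq_mul]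
  obtain ⟨C, hC, hlt⟩ := exists_submodule_forall_finrank_inf_lt _ _ (hsum.trans_lt h)
  rw [finrank_fin_fun] at hC
  have hkC : k ≤ finrank F C := by omega
  exact ⟨C, hkC, le_weight_bot (htk.trans hkC) hdn fun I hI =>
    hlt I (Finset.mem_powersetCard.2 ⟨Finset.subset_univ I, hI⟩)⟩

end Weight

section Entropy

theorem entropy_eq_binEntropy_div_log (q : ℕ) (x : ℝ) :
    entropy q x = Real.binEntropy x / Real.log q := by
  simp only [entropy, Real.binEntropy_eq_negMulLog_add_negMulLog_one_sub, Real.negMulLog,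
    Real.logb]
  ring

theorem continuous_entropy (q : ℕ) : Continuous (entropy q) := by
  simp_rw [funext (entropy_eq_binEntropy_div_log q)]
  exact Real.binEntropy_continuous.div_const _

theorem concaveOn_entropy (q : ℕ) : ConcaveOn ℝ (Set.Icc 0 1) (entropy q) := by
  simp_rw [funext (entropy_eq_binEntropy_div_log q), div_eq_inv_mul]
  exact Real.strictConcave_binEntropy.concaveOn.smul (inv_nonneg.2 (Real.log_natCast_nonneg q))

theorem entropy_nonneg (q : ℕ) {x : ℝ} (hx₀ : 0 ≤ x) (hx₁ : x ≤ 1) : 0 ≤ entropy q x := by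
  rw [entropy_eq_binEntropy_div_log]
  exact div_nonneg (Real.binEntropy_nonneg hx₀ hx₁) (Real.log_natCast_nonneg q)

theorem choose_mul_pow_mul_pow_le_add_pow {R : Type*} [CommSemiring R] [PartialOrder R]
    [IsOrderedRing R] {x y : R} (hx : 0 ≤ x) (hy : 0 ≤ y) {n d : ℕ} (hd : d ≤ n) :
    n.choose d * (x ^ d * y ^ (n - d)) ≤ (x + y) ^ n := by
  rw [add_pow, mul_comm]
  exact Finset.single_le_sum (f := fun m => x ^ m * y ^ (n - m) * (n.choose m : R))
    (fun m _ => by positivity) (Finset.mem_range_succ_iff.2 hd)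

theorem log_choose_le_mul_binEntropy {n d : ℕ} (hd : d ≤ n) :
    Real.log (n.choose d) ≤ n * Real.binEntropy (d / n) := by
  rcases Nat.eq_zero_or_pos d with rfl | hd₀
  · simp
  rcases hd.eq_or_lt with rfl | hlt
  · simp [hd₀.ne']
  have hn : (0 : ℝ) < n := by exact_mod_cast hd₀.trans hlt
  obtain ⟨x, hx⟩ : ∃ x : ℝ, x = d / n := ⟨_, rfl⟩
  have hnx : (d : ℝ) = n * x := by rw [hx]; field_simp
  have hx₀ : 0 < x := hx ▸ div_pos (by exact_mod_cast hd₀) hn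
  have hx₁ : 0 < 1 - x := by
    rw [hx, sub_pos, div_lt_one hn]
    exact_mod_cast hlt
  have hC : (0 : ℝ) < n.choose d := by exact_mod_cast Nat.choose_pos hd
  have hle : n.choose d * (x ^ d * (1 - x) ^ (n - d)) ≤ 1 := by
    simpa using choose_mul_pow_mul_pow_le_add_pow hx₀.le hx₁.le hd
  have hlog := Real.log_nonpos (by positivity) hle
  rw [Real.log_mul hC.ne' (by positivity), Real.log_mul (by positivity) (by positivity),
    Real.log_pow, Real.log_pow, Nat.cast_sub hd, hnx] at hlog
  rw [← hx, Real.binEntropy_eq_negMulLog_add_negMulLog_one_sub, Real.negMulLog, Real.negMulLog]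
  linarith

theorem choose_le_rpow_entropy {q n d : ℕ} (hq : 1 < q) (hd : d ≤ n) :
    (n.choose d : ℝ) ≤ (q : ℝ) ^ (n * entropy q (d / n)) := by
  have hlog : 0 < Real.log q := Real.log_pos (by exact_mod_cast hq)
  rw [Real.le_rpow_iff_log_le (by exact_mod_cast Nat.choose_pos hd) (by positivity),
    entropy_eq_binEntropy_div_log, mul_assoc, div_mul_cancel₀ _ hlog.ne']
  exact log_choose_le_mul_binEntropy hd

/-- The Gilbert–Varshamov exponent `x + H_q(x) / t`: at most `q ^ (t n (x + H_q(x) / t))` `t`-tuples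
of words of length `n` are supported in a common set of `x n` coordinates. In terms of it, the
condition `δ ≤ 1 - H_q(δ) / t - R₁` reads `gvExponent q t δ ≤ 1 - R₁`. -/
noncomputable def gvExponent (q t : ℕ) (x : ℝ) : ℝ :=
  x + entropy q x / t

theorem continuous_gvExponent (q t : ℕ) : Continuous (gvExponent q t) :=
  continuous_id.add ((continuous_entropy q).div_const _)

variable {q t : ℕ}

@[simp]
theorem gvExponent_one : gvExponent q t 1 = 1 := by
  simp [gvExponent, entropy_eq_binEntropy_div_log]

theorem gvExponent_nonneg {x : ℝ} (hx₀ : 0 ≤ x) (hx₁ : x ≤ 1) : 0 ≤ gvExponent q t x :=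
  add_nonneg hx₀ (div_nonneg (entropy_nonneg q hx₀ hx₁) t.cast_nonneg)

theorem concaveOn_gvExponent : ConcaveOn ℝ (Set.Icc 0 1) (gvExponent q t) := by
  simp_rw [funext fun x => show gvExponent q t x = x + (t : ℝ)⁻¹ • entropy q x by
    rw [gvExponent, div_eq_inv_mul, smul_eq_mul]]
  exact (concaveOn_id (convex_Icc 0 1)).add
    ((concaveOn_entropy q).smul (inv_nonneg.2 t.cast_nonneg))

theorem gvExponent_lt_gvExponent {x y : ℝ} (hx : 0 ≤ x) (hxy : x < y) (hy : y ≤ 1)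
    (h : gvExponent q t y < 1) : gvExponent q t x < gvExponent q t y := by
  have hy₁ : y < 1 := hy.lt_of_ne fun hy => by simp [hy] at h
  refine concaveOn_gvExponent.left_lt_of_lt_right ⟨hx, hxy.le.trans hy⟩ ⟨zero_le_one, le_rfl⟩ ?_
    (h.trans_eq gvExponent_one.symm)
  rw [openSegment_eq_Ioo (hxy.trans hy₁)]
  exact ⟨hxy, hy₁⟩

theorem choose_mul_pow_le_rpow_gvExponent {n d : ℕ} (hq : 1 < q) (ht : t ≠ 0) (hd : d ≤ n) :
    (n.choose d : ℝ) * (q : ℝ) ^ (d * t) ≤ (q : ℝ) ^ (n * t * gvExponent q t (d / n)) := by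
  rcases n.eq_zero_or_pos with rfl | hn
  · simp [Nat.le_zero.1 hd]
  have hexp : n * t * gvExponent q t (d / n) = n * entropy q (d / n) + ((d * t : ℕ) : ℝ) := by
    rw [gvExponent]
    push_cast
    field_simp
    ring
  rw [hexp, Real.rpow_add (by positivity), Real.rpow_natCast]
  gcongr
  exact choose_le_rpow_entropy hq hd

theorem exists_le_finrank_and_le_weight_bot_of_gvExponent_lt [Fintype F] {n k d : ℕ} (hn : 0 < n)
    (ht : t ≠ 0) (htk : t ≤ k) (hdn : d ≤ n)
    (h : gvExponent (Fintype.card F) t (d / n) + k / n < 1) :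
    ∃ C : Submodule F (Fin n → F), k ≤ finrank F C ∧ d ≤ weight t C ⊥ := by
  have hn' : (0 : ℝ) < n := by exact_mod_cast hn
  have ht' : (0 : ℝ) < t := by exact_mod_cast ht.bot_lt
  have hq : 1 < Fintype.card F := Fintype.one_lt_card
  have hkn : k ≤ n := by
    have hg : 0 ≤ gvExponent (Fintype.card F) t (d / n) :=
      gvExponent_nonneg (by positivity) (div_le_one_of_le₀ (by exact_mod_cast hdn) hn'.le)
    exact_mod_cast (div_le_one hn').1 (show (k : ℝ) / n ≤ 1 by linarith)
  have hexp : n * t * gvExponent (Fintype.card F) t (d / n) < ((n - k) * t : ℕ) := by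
    have hlt : gvExponent (Fintype.card F) t (d / n) < (n - k) / n := by
      rw [sub_div, div_self hn'.ne']
      linarith
    rw [lt_div_iff₀ hn'] at hlt
    calc n * t * gvExponent (Fintype.card F) t (d / n)
        = gvExponent (Fintype.card F) t (d / n) * n * t := by ring
      _ < (n - k) * t := mul_lt_mul_of_pos_right hlt ht'
      _ = ((n - k) * t : ℕ) := by push_cast [Nat.cast_sub hkn]; rfl
  refine exists_le_finrank_and_le_weight_bot htk hkn hdn ?_
  have hcount := (choose_mul_pow_le_rpow_gvExponent hq ht hdn).trans_lt
    (Real.rpow_lt_rpow_of_exponent_lt (by exact_mod_cast hq) hexp)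
  rw [Real.rpow_natCast] at hcount
  exact_mod_cast hcount

end Entropy

section DeltaZero

variable {n t : ℕ} {R₁ R₂ : ℝ}

theorem le_of_mem_ratios (hn : n ≠ 0) {x : ℝ} (hx : x ∈ ratios F t R₁ R₂ n) :
    x ≤ 1 - R₁ + t / n := by
  obtain ⟨d, rfl, C₁, C₂, -, h, hR, -, hd⟩ := hx
  have hsingleton : (d : ℝ) + finrank F C₁ ≤ n + t := by
    exact_mod_cast (Nat.add_le_add_right hd _).trans (weight_add_finrank_le h)
  calc (d : ℝ) / n ≤ (n - n * R₁ + t) / n := by gcongr; linarith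
    _ = 1 - R₁ + t / n := by field_simp

theorem le_one_of_mem_ratios {x : ℝ} (hx : x ∈ ratios F t R₁ R₂ n) : x ≤ 1 := by
  obtain ⟨d, rfl, C₁, C₂, -, h, -, -, hd⟩ := hx
  exact div_le_one_of_le₀ (by exact_mod_cast hd.trans (weight_le h)) n.cast_nonneg

theorem sSup_ratios_nonneg : 0 ≤ sSup (ratios F t R₁ R₂ n) :=
  Real.sSup_nonneg <| by
    rintro _ ⟨d, rfl, -⟩
    positivity

theorem sSup_ratios_le_one : sSup (ratios F t R₁ R₂ n) ≤ 1 :=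
  Real.sSup_le (fun _ => le_one_of_mem_ratios) zero_le_one

theorem isBoundedUnder_le_sSup_ratios :
    IsBoundedUnder (· ≤ ·) atTop fun n : ℕ => sSup (ratios F t R₁ R₂ n) :=
  isBoundedUnder_of ⟨1, fun _ => sSup_ratios_le_one⟩

theorem isCoboundedUnder_le_sSup_ratios :
    IsCoboundedUnder (· ≤ ·) atTop fun n : ℕ => sSup (ratios F t R₁ R₂ n) :=
  IsBoundedUnder.isCoboundedUnder_le (isBoundedUnder_of ⟨0, fun _ => sSup_ratios_nonneg⟩)

theorem deltaZero_nonneg : 0 ≤ deltaZero F t R₁ R₂ :=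
  le_limsup_of_frequently_le (Frequently.of_forall fun _ => sSup_ratios_nonneg)
    isBoundedUnder_le_sSup_ratios

theorem deltaZero_le_one : deltaZero F t R₁ R₂ ≤ 1 :=
  limsup_le_of_le isCoboundedUnder_le_sSup_ratios (Eventually.of_forall fun _ => sSup_ratios_le_one)

theorem le_deltaZero_of_tendsto {u : ℕ → ℝ} {a : ℝ} (hu : Tendsto u atTop (nhds a))
    (h : ∀ᶠ n in atTop, u n ∈ ratios F t R₁ R₂ n) : a ≤ deltaZero F t R₁ R₂ := by
  rw [← hu.limsup_eq]
  refine limsup_le_limsup ?_ hu.isCoboundedUnder_le isBoundedUnder_le_sSup_ratios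
  filter_upwards [h] with n hn
  exact le_csSup ⟨1, fun _ => le_one_of_mem_ratios⟩ hn

theorem deltaZero_le (hR₁ : R₁ ≤ 1) : deltaZero F t R₁ R₂ ≤ 1 - R₁ := by
  have hlim : Tendsto (fun n : ℕ => 1 - R₁ + (t : ℝ) / n) atTop (nhds (1 - R₁)) := by
    simpa using (tendsto_const_div_atTop_nhds_zero_nat (t : ℝ)).const_add (1 - R₁)
  rw [← hlim.limsup_eq]
  refine limsup_le_limsup ?_ isCoboundedUnder_le_sSup_ratios hlim.isBoundedUnder_le
  filter_upwards [eventually_ne_atTop 0] with n hn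
  exact Real.sSup_le (fun _ => le_of_mem_ratios hn)
    (add_nonneg (sub_nonneg.2 hR₁) (by positivity))

theorem one_sub_le_deltaZero (ht : 1 ≤ t) (hR₁ : 0 ≤ R₁) (hle : R₁ ≤ R₂) :
    1 - R₁ ≤ deltaZero F t R₁ R₂ := by
  rcases le_or_gt 1 R₁ with hR | hR
  · exact (sub_nonpos.2 hR).trans deltaZero_nonneg
  have hfloor : Tendsto (fun n : ℕ => (⌊R₁ * n⌋₊ : ℝ) / n) atTop (nhds R₁) :=
    (tendsto_nat_floor_mul_div_atTop hR₁).comp tendsto_natCast_atTop_atTop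
  have hroom : ∀ᶠ n : ℕ in atTop, (⌊R₁ * n⌋₊ : ℝ) / n + t / n < 1 :=
    (hfloor.add (tendsto_const_div_atTop_nhds_zero_nat (t : ℝ))).eventually_lt_const
      (by simpa using hR)
  refine le_deltaZero_of_tendsto (hfloor.const_sub 1) ?_
  filter_upwards [hroom, eventually_gt_atTop 0] with n hlt hn
  have hn' : (0 : ℝ) < n := by exact_mod_cast hn
  have hkt : ⌊R₁ * n⌋₊ + t ≤ n := by
    rw [← add_div, div_lt_one hn'] at hlt
    exact_mod_cast hlt.le
  obtain ⟨C₁, C₂, hC, hC₁, hC₂, hw⟩ := exists_finrank_eq_and_sub_le_weight F ht hkt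
  refine ⟨n - ⌊R₁ * n⌋₊, ?_, C₁, C₂, hC, by omega, ?_, ?_, hw⟩
  · rw [Nat.cast_sub (by omega), sub_div, div_self hn'.ne']
  · have hceil := Nat.lt_floor_add_one (R₁ * n)
    have ht' : (1 : ℝ) ≤ t := by exact_mod_cast ht
    rw [hC₁, Nat.cast_add]
    linarith
  · rw [hC₂]
    calc (⌊R₁ * n⌋₊ : ℝ) ≤ R₁ * n := Nat.floor_le (by positivity)
      _ ≤ n * R₂ := by rw [mul_comm]; gcongr

theorem deltaZero_eq_one_sub (ht : 1 ≤ t) (hR₁ : 0 ≤ R₁) (hR₁' : R₁ ≤ 1) (hle : R₁ ≤ R₂) :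
    deltaZero F t R₁ R₂ = 1 - R₁ :=
  le_antisymm (deltaZero_le hR₁') (one_sub_le_deltaZero ht hR₁ hle)

variable [Fintype F] {δ : ℝ}

theorem le_deltaZero_of_gvExponent_lt (ht : 1 ≤ t) (hR₁ : 0 ≤ R₁) (hR₂ : 0 ≤ R₂) (hδ₀ : 0 ≤ δ)
    (hδ₁ : δ ≤ 1) (h : gvExponent (Fintype.card F) t δ < 1 - R₁) :
    δ ≤ deltaZero F t R₁ R₂ := by
  have hd : Tendsto (fun n : ℕ => (⌊δ * n⌋₊ : ℝ) / n) atTop (nhds δ) :=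
    (tendsto_nat_floor_mul_div_atTop hδ₀).comp tendsto_natCast_atTop_atTop
  have hk : Tendsto (fun n : ℕ => ((⌈R₁ * n⌉₊ + t : ℕ) : ℝ) / n) atTop (nhds R₁) := by
    simpa [add_div] using
      ((tendsto_nat_ceil_mul_div_atTop hR₁).comp tendsto_natCast_atTop_atTop).add
        (tendsto_const_div_atTop_nhds_zero_nat (t : ℝ))
  have hlim := (((continuous_gvExponent (Fintype.card F) t).tendsto δ).comp hd).add hk
  refine le_deltaZero_of_tendsto hd ?_
  filter_upwards [hlim.eventually_lt_const (lt_sub_iff_add_lt.1 h), eventually_gt_atTop 0]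
    with n hlt hn
  have hdn : ⌊δ * n⌋₊ ≤ n :=
    Nat.floor_le_of_le (mul_le_of_le_one_left n.cast_nonneg hδ₁)
  obtain ⟨C, hC, hw⟩ := exists_le_finrank_and_le_weight_bot_of_gvExponent_lt hn (by omega)
    (Nat.le_add_left t _) hdn hlt
  refine ⟨_, rfl, C, ⊥, bot_le, by rw [finrank_bot]; omega, ?_, ?_, hw⟩
  · calc (n : ℝ) * R₁ ≤ ⌈R₁ * n⌉₊ := by rw [mul_comm]; exact Nat.le_ceil _
      _ ≤ finrank F C := by exact_mod_cast (Nat.le_add_right _ t).trans hC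
  · rw [finrank_bot, Nat.cast_zero]
    positivity

theorem le_deltaZero_of_gvExponent_le (ht : 1 ≤ t) (hR₁ : 0 ≤ R₁) (hR₂ : 0 ≤ R₂) (hδ₁ : δ ≤ 1)
    (h : gvExponent (Fintype.card F) t δ ≤ 1 - R₁) : δ ≤ deltaZero F t R₁ R₂ := by
  rcases hR₁.eq_or_lt with rfl | hpos
  · exact (hδ₁.trans_eq (sub_zero 1).symm).trans (one_sub_le_deltaZero ht le_rfl hR₂)
  refine le_of_forall_lt_imp_le_of_dense fun c hc => ?_
  rcases lt_or_ge c 0 with hc₀ | hc₀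
  · exact hc₀.le.trans deltaZero_nonneg
  · exact le_deltaZero_of_gvExponent_lt ht hR₁ hR₂ hc₀ (hc.le.trans hδ₁)
      ((gvExponent_lt_gvExponent hc₀ hc hδ₁ (by linarith)).trans_le h)

theorem one_sub_le_gvExponent_deltaZero (ht : 1 ≤ t) (hR₁ : 0 ≤ R₁) (hR₂ : 0 ≤ R₂) :
    1 - R₁ ≤ gvExponent (Fintype.card F) t (deltaZero F t R₁ R₂) := by
  rcases (deltaZero_le_one (F := F) (t := t) (R₁ := R₁) (R₂ := R₂)).eq_or_lt with h₁ | h₁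
  · simpa [h₁] using hR₁
  have hright : Tendsto (gvExponent (Fintype.card F) t)
      (nhdsWithin (deltaZero F t R₁ R₂) (Set.Ioi (deltaZero F t R₁ R₂)))
      (nhds (gvExponent (Fintype.card F) t (deltaZero F t R₁ R₂))) :=
    (continuous_gvExponent _ _).continuousWithinAt
  refine ge_of_tendsto hright ?_
  filter_upwards [Ioo_mem_nhdsGT h₁] with x hx
  by_contra! hlt
  exact (le_deltaZero_of_gvExponent_le ht hR₁ hR₂ hx.2.le hlt.le).not_gt hx.1

end DeltaZero

end RGHW

theorem mainTheorem4 (F : Type*) [Field F] [Fintype F] (t : ℕ) (ht : 1 ≤ t) :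
    (∀ R₁ : ℝ, 0 ≤ R₁ → R₁ ≤ 1 → RGHW.deltaZero F t R₁ R₁ = 1 - R₁) ∧
    (∀ R₁ R₂ : ℝ, 0 ≤ R₁ → R₁ ≤ 1 → 0 ≤ R₂ →
      (∀ δ : ℝ, 0 ≤ δ → δ ≤ 1 →
        δ ≤ 1 - RGHW.entropy (Fintype.card F) δ / t - R₁ →
        δ ≤ RGHW.deltaZero F t R₁ R₂) ∧
      1 - RGHW.entropy (Fintype.card F) (RGHW.deltaZero F t R₁ R₂) / t - R₁ ≤
        RGHW.deltaZero F t R₁ R₂) := by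
  refine ⟨fun R₁ h₀ h₁ => RGHW.deltaZero_eq_one_sub ht h₀ h₁ le_rfl,
    fun R₁ R₂ h₀ _ h₂ => ⟨fun δ _ hδ₁ hδ => ?_, ?_⟩⟩
  · refine RGHW.le_deltaZero_of_gvExponent_le ht h₀ h₂ hδ₁ ?_
    rw [RGHW.gvExponent]
    linarith
  · have h := RGHW.one_sub_le_gvExponent_deltaZero (F := F) ht h₀ h₂
    rw [RGHW.gvExponent] at h
    linarith
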